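/- Let $A$ be a $\mathrm{C}^*$-algebra (not necessarily unital), let $n$ be a natural number and let $\sigma=(\sigma_1,\dots,\sigma_n)$ be an $n$-tuple of $*$-automorphisms of $A$ (an automorphic multivariable $\mathrm{C}^*$-dynamical system). A contractive covariant representation of $(A,\sigma)$ consists of a $*$-representation $\pi$ of $A$ on a Hilbert space $H$ and contractions $S_1,\dots,S_n\in B(H)$ with $\pi(a)S_i=S_i\pi(\sigma_i(a))$ for all $a\in A$ and all $i$. The semicrossed product $A\times_\sigma\mathbb{F}_n^+$ is the universal norm-closed operator algebra for contractive covariant representations, that is, the norm-closed algebra generated by $A$ and $S_1A,\dots,S_nA$, where the norm is the supremum over all contractive covariant representations. The crossed product $A\times_\sigma\mathbb{F}_n$ is the universal $\mathrm{C}^*$-algebra generated by $A$ and $U_1A,\dots,U_nA$ for covariant representations in which the $n$ operators are unitaries $U_1,\dots,U_n$ (the full crossed product by the free group on $n$ generators). Assume that $A\times_\sigma\mathbb{F}_n$ is residually finite dimensional, i.e. its $*$-representations on finite dimensional Hilbert spaces separate its points. Then every approximately local left multiplier on $B=A\times_\sigma\mathbb{F}_n^+$ is a left multiplier. That is: if $T:B\to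 B$ is a bounded linear map such that for every $a\in B$ there is a sequence $(x_k)_k$ in $B$ with $T(a)=\lim_k x_k a$, then $T(ab)=T(a)b$ for all $a,b\in B$. -/

import Mathlib

open Filter Topology
open scoped ENNReal

noncomputable section

namespace MultivarDyn

universe u

/-! An automorphic multivariable C*-dynamical system is a C*-algebra `A` (with or without a unit)
with an `n`-tuple `σ : Fin n → (A ≃⋆ₐ[ℂ] A)` of *-automorphisms of `A`. -/

variable {A : Type u} [NonUnitalCStarAlgebra A] {n : ℕ}

/-- A (contractive) covariant representation of `(A, σ)` on a Hilbert space `H`: a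
*-representation `π` of `A` and contractions `S₁, …, Sₙ`, subject to no relation other than
`π(a) Sᵢ = Sᵢ π(σᵢ(a))`.

The Hilbert spaces live in the universe of `A`. As a covariant representation is the direct sum of
subrepresentations that have a dense subset no larger than `A` or the continuum, all covariant
representations are accounted for up to unitary equivalence and direct sums. -/
structure CovRep (σ : Fin n → (A ≃⋆ₐ[ℂ] A)) : Type (u + 1) where
  /-- the Hilbert space -/
  H : Type u
  [instNACG : NormedAddCommGroup H]
  [instIPS : InnerProductSpace ℂ H]
  [instComplete : CompleteSpace H]
  /-- the representation of the C*-algebra -/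
  π : A →⋆ₙₐ[ℂ] (H →L[ℂ] H)
  /-- the contractions -/
  S : Fin n → (H →L[ℂ] H)
  norm_S_le : ∀ i, ‖S i‖ ≤ 1
  covariant : ∀ (i : Fin n) (a : A), π a * S i = S i * π (σ i a)

attribute [instance] CovRep.instNACG CovRep.instIPS CovRep.instComplete

/-- The covariant representations whose `n` operators are unitaries. An `n`-tuple of unitaries is
the same thing as a unitary representation of the free group `𝔽ₙ`, so these are the covariant
representations of `A` with the action of `𝔽ₙ` that the automorphisms generate. -/
abbrev UnitaryCovRep (σ : Fin n → (A ≃⋆ₐ[ℂ] A)) : Type (u + 1) :=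
  {r : CovRep σ // ∀ i, r.S i ∈ unitary (r.H →L[ℂ] r.H)}

section Family

variable {σ : Fin n → (A ≃⋆ₐ[ℂ] A)} {ι : Type*} (ρ : ι → CovRep σ)

/-- The C*-algebra of bounded families of operators on the Hilbert spaces of a family `ρ` of
covariant representations (block diagonal operators on the Hilbert space direct sum), with the
supremum norm and pointwise operations. -/
def BlockOps : Type _ := lp (fun r : ι => ((ρ r).H →L[ℂ] (ρ r).H)) ∞

instance : NonUnitalCStarAlgebra (BlockOps ρ) :=
  inferInstanceAs (NonUnitalCStarAlgebra (lp (fun r : ι => ((ρ r).H →L[ℂ] (ρ r).H)) ∞))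

/-- The copy of `a ∈ A`: the family `(π_r(a))_r`. -/
def coeff (a : A) : BlockOps ρ :=
  ⟨fun r => (ρ r).π a, memℓp_infty ⟨‖a‖, by
    rintro _ ⟨r, rfl⟩
    exact NonUnitalStarAlgHom.norm_apply_le (ρ r).π a⟩⟩

/-- The element `Sᵢ a`: the family `(S_{r,i} π_r(a))_r`. -/
def shiftCoeff (i : Fin n) (a : A) : BlockOps ρ :=
  ⟨fun r => (ρ r).S i * (ρ r).π a, memℓp_infty ⟨‖a‖, by
    rintro _ ⟨r, rfl⟩
    calc ‖(ρ r).S i * (ρ r).π a‖ ≤ ‖(ρ r).S i‖ * ‖(ρ r).π a‖ := norm_mul_le _ _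
      _ ≤ 1 * ‖a‖ := mul_le_mul ((ρ r).norm_S_le i)
          (NonUnitalStarAlgHom.norm_apply_le (ρ r).π a) (norm_nonneg _) zero_le_one
      _ = ‖a‖ := one_mul _⟩⟩

/-- The generators: `A` together with `S₁A, …, SₙA`. -/
def generators : Set (BlockOps ρ) :=
  Set.range (coeff ρ) ∪ ⋃ i : Fin n, Set.range (shiftCoeff ρ i)

end Family

/-- The semicrossed product `A ×_σ 𝔽ₙ⁺`: the universal norm-closed operator algebra of the
contractive covariant representations of `(A, σ)`, that is, the norm-closed (in general not
self-adjoint) algebra generated by `A` and `S₁A, …, SₙA` in the direct sum of all of them.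
The norm of a polynomial in the generators is the supremum of the norms of its images under all
contractive covariant representations. -/
def Semicrossed (σ : Fin n → (A ≃⋆ₐ[ℂ] A)) :
    NonUnitalSubalgebra ℂ (BlockOps (fun r : CovRep σ => r)) :=
  (NonUnitalAlgebra.adjoin ℂ (generators (fun r : CovRep σ => r))).topologicalClosure

/-- The full crossed product C*-algebra `A ×_σ 𝔽ₙ`: the universal C*-algebra of the covariant
representations of `(A, σ)` by unitaries, that is, the C*-algebra generated by `A` and
`U₁A, …, UₙA` in the direct sum of all of them. -/
def Crossed (σ : Fin n → (A ≃⋆ₐ[ℂ] A)) :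
    NonUnitalStarSubalgebra ℂ (BlockOps (fun r : UnitaryCovRep σ => r.1)) :=
  (NonUnitalStarAlgebra.adjoin ℂ
    (generators (fun r : UnitaryCovRep σ => r.1))).topologicalClosure

/-- A C*-algebra is residually finite dimensional if its *-representations on finite dimensional
Hilbert spaces separate its points. -/
def IsRFD (C : Type*) [NonUnitalNonAssocSemiring C] [Module ℂ C] [Star C] : Prop :=
  ∀ x : C, x ≠ 0 → ∃ (k : ℕ)
    (φ : C →⋆ₙₐ[ℂ] (EuclideanSpace ℂ (Fin k) →L[ℂ] EuclideanSpace ℂ (Fin k))), φ x ≠ 0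

section Multipliers

variable {B : Type*} [NonUnitalNonAssocSemiring B] [TopologicalSpace B] [Module ℂ B]

/-- A bounded linear map `T` on `B` is a left multiplier if `T(ab) = T(a)b`. -/
def IsLeftMultiplier (T : B →L[ℂ] B) : Prop :=
  ∀ a b : B, T (a * b) = T a * b

/-- A bounded linear map `T` on `B` is an approximately local left multiplier if for every `a`
there is a sequence `x₀, x₁, …` in `B` (which may depend on `a`) with `T(a) = lim xₖ a`. -/
def IsApproxLocalLeftMultiplier (T : B →L[ℂ] B) : Prop :=
  ∀ a : B, ∃ x : ℕ → B, Tendsto (fun k => x k * a) atTop (𝓝 (T a))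

end Multipliers

end MultivarDyn

end

/-!
The proof has two halves, joined by residual finite dimensionality: the finite dimensional
representations of the crossed product separate its points, and hence those of the semicrossed
product by the first half, while the second half shows that `T` is a left multiplier in each of them.

**The semicrossed product embeds in the crossed product** (`toCrossed_injective`). No dilation of
the individual contractions is needed. On `ℓ²(Aut A, H)` the amplified representation `amplify π`
of a covariant representation `(π, S)` on `H` admits covariant unitaries `Uᵢ` (permutations of the
coordinates), and `(π, S)` sits inside it at the coordinate of `1`. There every covariant
contraction has the form `Uᵢ Cᵢ` with `Cᵢ` in the commutant of the representation, and for `x` in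
the semicrossed product the value at `(Uᵢ Cᵢ)ᵢ` is an analytic function of `C`, being a uniform limit of noncommutative polynomials. If it vanishes
whenever all `Uᵢ Cᵢ` are unitary, then it vanishes for self-adjoint strict contractions `Pᵢ` by the
maximum principle along the Möbius transforms `(Pᵢ + z)(1 + zPᵢ)⁻¹`, which are unitary for
`|z| = 1`; hence for small `C` by the identity theorem along `Re C + z Im C`, and hence for all
contractions by the identity theorem along `zC` (`evalAt_eq_zero_of_unitary`).

**Finite dimensional representations of the crossed product turn `T` into a left multiplier.** If
`ψ` is the restriction of such a representation, `ψ(b)ξ = 0` implies `ψ(T(b))ξ = 0`. If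
`ψ(h)ξ = μξ`, then this applies to `bh - μb`, so `ψ(T(bh))ξ = ψ(T(b))ψ(h)ξ`. Therefore
`ψ(T(bh)) = ψ(T(b))ψ(h)` whenever `ψ(h)` is diagonalizable, in particular whenever it is normal. Such
`h` generate: self-adjoint elements of `A` are normal, and if `e ∈ A` acts as the unit of the image of
`A`, then `Sᵢ e` acts as an isometry of a finite dimensional space, hence as a unitary of it, and
`Sᵢ a` has the same image as `Sᵢ e · a`.
-/

open Filter Topology
open scoped ENNReal

noncomputable section

namespace MultivarDyn

universe u

variable {A : Type u} [NonUnitalCStarAlgebra A] {n : ℕ}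

/-! ### Bounded families of operators -/

section Components

variable {σ : Fin n → (A ≃⋆ₐ[ℂ] A)} {ι κ : Type*} (ρ : ι → CovRep σ)

/-- The compression of a block diagonal operator to the summand of index `r`, that is, the
`*`-homomorphism evaluating a bounded family of operators at `r`. -/
def component (r : ι) : BlockOps ρ →⋆ₙₐ[ℂ] ((ρ r).H →L[ℂ] (ρ r).H) where
  toFun x := x.1 r
  map_smul' _ _ := rfl
  map_zero' := rfl
  map_add' _ _ := rfl
  map_mul' _ _ := rfl
  map_star' _ := rfl

@[simp] theorem component_coeff (r : ι) (a : A) : component ρ r (coeff ρ a) = (ρ r).π a := rfl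

@[simp] theorem component_shiftCoeff (r : ι) (i : Fin n) (a : A) :
    component ρ r (shiftCoeff ρ i a) = (ρ r).S i * (ρ r).π a := rfl

variable {ρ} in
theorem BlockOps.ext {x y : BlockOps ρ} (h : ∀ r, component ρ r x = component ρ r y) : x = y :=
  lp.ext (funext h)

theorem norm_component_le (r : ι) (x : BlockOps ρ) : ‖component ρ r x‖ ≤ ‖x‖ :=
  NonUnitalStarAlgHom.norm_apply_le _ x

/-- Reindexing a bounded family of operators along `f : κ → ι`; for injective `f` this discards
the summands outside the range of `f`. -/
def reindex (f : κ → ι) : BlockOps ρ →⋆ₙₐ[ℂ] BlockOps (fun k => ρ (f k)) where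
  toFun x := ⟨fun k => x.1 (f k), memℓp_infty ⟨‖x‖, by
    rintro _ ⟨k, rfl⟩
    exact norm_component_le ρ (f k) x⟩⟩
  map_smul' _ _ := rfl
  map_zero' := rfl
  map_add' _ _ := rfl
  map_mul' _ _ := rfl
  map_star' _ := rfl

/-- `coeff ρ` as a `*`-homomorphism. -/
def coeffHom : A →⋆ₙₐ[ℂ] BlockOps ρ where
  toFun := coeff ρ
  map_smul' c a := BlockOps.ext fun r => by simp
  map_zero' := BlockOps.ext fun r => by simp
  map_add' a b := BlockOps.ext fun r => by simp
  map_mul' a b := BlockOps.ext fun r => by simp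
  map_star' a := BlockOps.ext fun r => by simp [map_star]

theorem shiftCoeff_mul_coeff (i : Fin n) (a b : A) :
    shiftCoeff ρ i a * coeff ρ b = shiftCoeff ρ i (a * b) :=
  BlockOps.ext fun r => by simp [mul_assoc]

theorem star_shiftCoeff_mul_shiftCoeff (i : Fin n)
    (hρ : ∀ r, (ρ r).S i ∈ unitary ((ρ r).H →L[ℂ] (ρ r).H)) (a b : A) :
    star (shiftCoeff ρ i a) * shiftCoeff ρ i b = coeff ρ (star a * b) :=
  BlockOps.ext fun r => by
    simp only [map_mul, map_star, component_shiftCoeff, component_coeff, star_mul]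
    rw [mul_assoc, ← mul_assoc (star ((ρ r).S i)), Unitary.star_mul_self_of_mem (hρ r), one_mul]

theorem shiftCoeff_mul_star_shiftCoeff (i : Fin n)
    (hρ : ∀ r, (ρ r).S i ∈ unitary ((ρ r).H →L[ℂ] (ρ r).H)) (a b : A) :
    shiftCoeff ρ i a * star (shiftCoeff ρ i b) = coeff ρ ((σ i).symm (a * star b)) :=
  BlockOps.ext fun r => by
    have h := (ρ r).covariant i ((σ i).symm (a * star b))
    rw [StarAlgEquiv.apply_symm_apply] at h
    simp only [map_mul, map_star, component_shiftCoeff, component_coeff, star_mul]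
    rw [mul_assoc, ← mul_assoc ((ρ r).π a), ← map_star, ← map_mul, ← mul_assoc, ← h, mul_assoc,
      Unitary.mul_star_self_of_mem (hρ r), mul_one]
    simp only [map_mul, map_star]

end Components

/-! ### Analytic dependence on the contractions -/

section Analytic

variable {σ : Fin n → (A ≃⋆ₐ[ℂ] A)}
  {K : Type u} [NormedAddCommGroup K] [InnerProductSpace ℂ K] [CompleteSpace K]

/-- The tuples of contractions that form a covariant representation together with `π`. -/
def covariantContractions (σ : Fin n → (A ≃⋆ₐ[ℂ] A)) (π : A →⋆ₙₐ[ℂ] (K →L[ℂ] K)) :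
    Set (Fin n → (K →L[ℂ] K)) :=
  {S | (∀ i, ‖S i‖ ≤ 1) ∧ ∀ i a, π a * S i = S i * π (σ i a)}

/-- The covariant representation given by `π` and a tuple in `covariantContractions σ π`. -/
@[simps]
def CovRep.ofMem {π : A →⋆ₙₐ[ℂ] (K →L[ℂ] K)} {S : Fin n → (K →L[ℂ] K)}
    (hS : S ∈ covariantContractions σ π) : CovRep σ where
  H := K
  π := π
  S := S
  norm_S_le := hS.1
  covariant := hS.2

open Classical in
/-- The image of `x` under the covariant representation `(π, S)`, as a function of the tuple `S`;
it is set to `0` where `(π, S)` is not a contractive covariant representation. -/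
def evalAt (π : A →⋆ₙₐ[ℂ] (K →L[ℂ] K)) (x : BlockOps (fun r : CovRep σ => r))
    (S : Fin n → (K →L[ℂ] K)) : K →L[ℂ] K :=
  if hS : S ∈ covariantContractions σ π then
    component (fun r : CovRep σ => r) (CovRep.ofMem hS) x else 0

theorem evalAt_of_mem {π : A →⋆ₙₐ[ℂ] (K →L[ℂ] K)} (x : BlockOps (fun r : CovRep σ => r))
    {S : Fin n → (K →L[ℂ] K)} (hS : S ∈ covariantContractions σ π) :
    evalAt π x S = component (fun r : CovRep σ => r) (CovRep.ofMem hS) x := dif_pos hS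

theorem dist_evalAt_le {π : A →⋆ₙₐ[ℂ] (K →L[ℂ] K)} (x y : BlockOps (fun r : CovRep σ => r))
    {S : Fin n → (K →L[ℂ] K)} (hS : S ∈ covariantContractions σ π) :
    dist (evalAt π x S) (evalAt π y S) ≤ dist x y := by
  rw [evalAt_of_mem x hS, evalAt_of_mem y hS]
  have h := norm_component_le (fun r : CovRep σ => r) (CovRep.ofMem hS) (x - y)
  rw [map_sub, ← dist_eq_norm, ← dist_eq_norm] at h
  exact h

/-- On the covariant tuples, polynomials in the generators are evaluated by noncommutative
polynomials in `S`, and these are entire. -/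
theorem exists_differentiable_eqOn_evalAt (π : A →⋆ₙₐ[ℂ] (K →L[ℂ] K))
    {x : BlockOps (fun r : CovRep σ => r)}
    (hx : x ∈ NonUnitalAlgebra.adjoin ℂ (generators (fun r : CovRep σ => r))) :
    ∃ G : (Fin n → (K →L[ℂ] K)) → (K →L[ℂ] K), Differentiable ℂ G ∧
      Set.EqOn G (evalAt π x) (covariantContractions σ π) := by
  induction hx using NonUnitalAlgebra.adjoin_induction with
  | mem x hx =>
    rcases hx with ⟨a, rfl⟩ | hx
    · exact ⟨fun _ => π a, differentiable_const _, fun S hS => by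
        rw [evalAt_of_mem _ hS, component_coeff]; rfl⟩
    · obtain ⟨i, a, rfl⟩ := Set.mem_iUnion.1 hx
      exact ⟨fun S => S i * π a, by fun_prop, fun S hS => by
        rw [evalAt_of_mem _ hS, component_shiftCoeff]; rfl⟩
  | add x y _ _ hx hy =>
    obtain ⟨G, hG, hGx⟩ := hx
    obtain ⟨F, hF, hFy⟩ := hy
    refine ⟨G + F, hG.add hF, fun S hS => ?_⟩
    rw [Pi.add_apply, hGx hS, hFy hS]
    simp only [evalAt_of_mem _ hS, map_add]
    rfl
  | zero =>
    refine ⟨0, differentiable_const _, fun S hS => ?_⟩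
    rw [evalAt_of_mem _ hS, map_zero]
    rfl
  | mul x y _ _ hx hy =>
    obtain ⟨G, hG, hGx⟩ := hx
    obtain ⟨F, hF, hFy⟩ := hy
    refine ⟨G * F, hG.mul hF, fun S hS => ?_⟩
    rw [Pi.mul_apply, hGx hS, hFy hS]
    simp only [evalAt_of_mem _ hS, map_mul]
    rfl
  | smul c x _ hx =>
    obtain ⟨G, hG, hGx⟩ := hx
    refine ⟨c • G, hG.const_smul c, fun S hS => ?_⟩
    rw [Pi.smul_apply, hGx hS]
    simp only [evalAt_of_mem _ hS, map_smul]
    rfl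

/-- Elements of the semicrossed product are evaluated by uniform limits of entire functions. -/
theorem exists_tendstoUniformlyOn_evalAt (π : A →⋆ₙₐ[ℂ] (K →L[ℂ] K))
    {x : BlockOps (fun r : CovRep σ => r)} (hx : x ∈ Semicrossed σ) :
    ∃ G : ℕ → (Fin n → (K →L[ℂ] K)) → (K →L[ℂ] K), (∀ k, Differentiable ℂ (G k)) ∧
      TendstoUniformlyOn G (evalAt π x) atTop (covariantContractions σ π) := by
  obtain ⟨y, hy, hyx⟩ := mem_closure_iff_seq_limit.1 hx
  choose G hG hGy using fun k => exists_differentiable_eqOn_evalAt π (hy k)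
  refine ⟨G, hG, Metric.tendstoUniformlyOn_iff.2 fun ε hε => ?_⟩
  filter_upwards [Metric.tendsto_nhds.1 hyx ε hε] with k hk S hS
  rw [hGy k hS, dist_comm]
  exact (dist_evalAt_le (y k) x hS).trans_lt hk

theorem continuousOn_evalAt_comp {π : A →⋆ₙₐ[ℂ] (K →L[ℂ] K)}
    {x : BlockOps (fun r : CovRep σ => r)} (hx : x ∈ Semicrossed σ)
    {c : ℂ → Fin n → (K →L[ℂ] K)} {s : Set ℂ} (hc : ContinuousOn c s)
    (hcs : Set.MapsTo c s (covariantContractions σ π)) :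
    ContinuousOn (fun z => evalAt π x (c z)) s := by
  obtain ⟨G, hG, hlim⟩ := exists_tendstoUniformlyOn_evalAt π hx
  exact ((hlim.comp c).mono hcs).continuousOn
    (.of_forall fun k => (hG k).continuous.comp_continuousOn hc)

theorem differentiableOn_evalAt_comp {π : A →⋆ₙₐ[ℂ] (K →L[ℂ] K)}
    {x : BlockOps (fun r : CovRep σ => r)} (hx : x ∈ Semicrossed σ)
    {c : ℂ → Fin n → (K →L[ℂ] K)} {s : Set ℂ} (hs : IsOpen s) (hc : DifferentiableOn ℂ c s)
    (hcs : Set.MapsTo c s (covariantContractions σ π)) :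
    DifferentiableOn ℂ (fun z => evalAt π x (c z)) s := by
  obtain ⟨G, hG, hlim⟩ := exists_tendstoUniformlyOn_evalAt π hx
  exact ((hlim.comp c).mono hcs).tendstoLocallyUniformlyOn.differentiableOn
    (.of_forall fun k => (hG k).comp_differentiableOn hc) hs

end Analytic

/-! ### Möbius transforms of self-adjoint contractions -/

section Moebius

variable {K : Type*} [NormedAddCommGroup K] [InnerProductSpace ℂ K]

/-- The Möbius transform `(P + z)(1 + zP)⁻¹` of an operator `P`. -/
def moebius (P : K →L[ℂ] K) (z : ℂ) : K →L[ℂ] K :=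
  (P + algebraMap ℂ _ z) * Ring.inverse (1 + z • P)

@[simp] theorem moebius_zero (P : K →L[ℂ] K) : moebius P 0 = P := by
  simp [moebius]

variable [CompleteSpace K]

theorem isUnit_one_add_smul {P : K →L[ℂ] K} (hP : ‖P‖ < 1) {z : ℂ} (hz : ‖z‖ ≤ 1) :
    IsUnit (1 + z • P) := by
  have : ‖-(z • P)‖ < 1 := by
    rw [norm_neg, norm_smul]
    nlinarith [norm_nonneg P, norm_nonneg z]
  simpa using isUnit_one_sub_of_norm_lt_one this

theorem differentiableAt_moebius {P : K →L[ℂ] K} (hP : ‖P‖ < 1) {z : ℂ} (hz : ‖z‖ ≤ 1) :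
    DifferentiableAt ℂ (moebius P) z := by
  have h1 : DifferentiableAt ℂ (fun z : ℂ => 1 + z • P) z := by fun_prop
  have h2 : DifferentiableAt ℂ (fun z : ℂ => Ring.inverse (1 + z • P)) z := by
    obtain ⟨w, hw⟩ := isUnit_one_add_smul hP hz
    exact DifferentiableAt.comp z (hw ▸ differentiableAt_inverse ⟨w, rfl⟩) h1
  have h3 : DifferentiableAt ℂ (fun z : ℂ => P + algebraMap ℂ (K →L[ℂ] K) z) z := by
    simp only [Algebra.algebraMap_eq_smul_one]
    fun_prop
  exact h3.mul h2

omit [CompleteSpace K] in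
theorem commute_moebius {P X : K →L[ℂ] K} (h : Commute X P) (z : ℂ) :
    Commute X (moebius P z) := by
  refine (h.add_right (Algebra.commute_algebraMap_right z X)).mul_right ?_
  by_cases hu : IsUnit (1 + z • P)
  · rw [Ring.inverse_of_isUnit hu]
    exact Commute.units_inv_right ((Commute.one_right X).add_right (h.smul_right z))
  · rw [Ring.inverse_non_unit _ hu]
    exact Commute.zero_right X

theorem norm_moebius_le {P : K →L[ℂ] K} (hP : ‖P‖ < 1) (hsa : IsSelfAdjoint P) {z : ℂ}
    (hz : ‖z‖ ≤ 1) : ‖moebius P z‖ ≤ 1 := by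
  -- `‖(1 + zP)y‖² - ‖(P + z)y‖² = (1 - |z|²)(‖y‖² - ‖Py‖²)`
  have key (y : K) : ‖P y + z • y‖ ≤ ‖y + z • P y‖ := by
    have h1 : ‖P y‖ ≤ ‖y‖ := (P.le_of_opNorm_le hP.le y).trans (one_mul _).le
    have h2 := @norm_add_sq ℂ K _ _ _ (P y) (z • y)
    have h3 := @norm_add_sq ℂ K _ _ _ y (z • P y)
    rw [inner_smul_right, norm_smul] at h2 h3
    have h4 : inner ℂ (P y) y = inner ℂ y (P y) := hsa.isSymmetric y y
    rw [h4] at h2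
    have h5 : 0 ≤ (1 - ‖z‖ ^ 2) * (‖y‖ ^ 2 - ‖P y‖ ^ 2) :=
      mul_nonneg (by nlinarith [norm_nonneg z]) (by nlinarith [norm_nonneg (P y)])
    exact le_of_sq_le_sq (by nlinarith) (norm_nonneg _)
  refine ContinuousLinearMap.opNorm_le_bound _ zero_le_one fun y => ?_
  have h := key (Ring.inverse (1 + z • P) y)
  have h' : (1 + z • P) (Ring.inverse (1 + z • P) y) = y := by
    rw [← mul_apply_eq_comp, Ring.mul_inverse_cancel _ (isUnit_one_add_smul hP hz)]
    rfl
  have h'' : Ring.inverse (1 + z • P) y + z • P (Ring.inverse (1 + z • P) y) = y := h'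
  rw [h''] at h
  simpa [moebius, Algebra.algebraMap_eq_smul_one] using h

theorem moebius_mem_unitary {P : K →L[ℂ] K} (hP : ‖P‖ < 1) (hsa : IsSelfAdjoint P) {z : ℂ}
    (hz : ‖z‖ = 1) : moebius P z ∈ unitary (K →L[ℂ] K) := by
  have hu := isUnit_one_add_smul hP hz.le
  have hz' : star z * z = 1 := by
    rw [Complex.star_def, ← Complex.normSq_eq_conj_mul_self, Complex.normSq_eq_norm_sq, hz]; simp
  have hz0 : z ≠ 0 := by rintro rfl; simp at hz
  -- on the unit circle, `P + z = z (1 + zP)*`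
  have e1 : P + algebraMap ℂ _ z = z • star (1 + z • P) := by
    rw [star_add, star_one, star_smul, hsa.star_eq, smul_add, smul_smul, mul_comm z, hz', one_smul,
      Algebra.algebraMap_eq_smul_one, add_comm]
  have e2 : star (moebius P z) * moebius P z = 1 := by
    have e3 : Commute (1 + z • P) (star (1 + z • P)) := by
      rw [star_add, star_one, star_smul, hsa.star_eq]
      exact ((Commute.one_left _).add_left
        (((Commute.one_right P).add_right ((Commute.refl P).smul_right _)).smul_left z))
    rw [moebius, e1, star_mul, star_smul, star_star, smul_mul_assoc, mul_smul_comm, mul_smul_comm,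
      smul_mul_assoc, smul_smul, mul_comm z, hz', one_smul, mul_assoc, ← mul_assoc (1 + z • P), e3.eq,
      mul_assoc, Ring.mul_inverse_cancel _ hu, mul_one, ← star_mul, Ring.mul_inverse_cancel _ hu,
      star_one]
  have e4 : IsUnit (moebius P z) := by
    rw [moebius, e1]
    exact (hu.star.smul (Units.mk0 z hz0)).mul hu.ringInverse
  exact e4.mem_unitary_of_star_mul_self e2

end Moebius

/-! ### Elements vanishing on unitary tuples -/

section Uniqueness

variable {σ : Fin n → (A ≃⋆ₐ[ℂ] A)}
  {K : Type u} [NormedAddCommGroup K] [InnerProductSpace ℂ K] [CompleteSpace K]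
  {π : A →⋆ₙₐ[ℂ] (K →L[ℂ] K)} {U : Fin n → (K →L[ℂ] K)}

theorem mul_mem_covariantContractions (hU : U ∈ covariantContractions σ π)
    {C : Fin n → (K →L[ℂ] K)} (hC : ∀ i a, Commute (π a) (C i)) (hC1 : ∀ i, ‖C i‖ ≤ 1) :
    (fun i => U i * C i) ∈ covariantContractions σ π := by
  refine ⟨fun i => (norm_mul_le _ _).trans (mul_le_one₀ (hU.1 i) (norm_nonneg _) (hC1 i)),
    fun i a => ?_⟩
  rw [← mul_assoc, hU.2, mul_assoc, (hC i _).eq, mul_assoc]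

/-- Two covariant tuples differ by elements of the commutant of `π(A)`. -/
theorem commute_star_mul (hU : U ∈ covariantContractions σ π)
    {S : Fin n → (K →L[ℂ] K)} (hS : S ∈ covariantContractions σ π) (i : Fin n) (a : A) :
    Commute (π a) (star (U i) * S i) := by
  have h := congrArg star (hU.2 i (star ((σ i).symm a)))
  have h' := hS.2 i ((σ i).symm a)
  simp only [star_mul, map_star, star_star, StarAlgEquiv.apply_symm_apply] at h h'
  rw [Commute, SemiconjBy, ← mul_assoc, ← h, mul_assoc, h', mul_assoc]

variable {x : BlockOps (fun r : CovRep σ => r)}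

/-- The Möbius transforms join `U P` to tuples of unitaries, and the maximum principle applies. -/
theorem evalAt_mul_selfAdjoint_eq_zero (hx : x ∈ Semicrossed σ)
    (hx0 : ∀ S ∈ covariantContractions σ π, (∀ i, S i ∈ unitary (K →L[ℂ] K)) → evalAt π x S = 0)
    (hU : U ∈ covariantContractions σ π) (hU' : ∀ i, U i ∈ unitary (K →L[ℂ] K))
    {P : Fin n → (K →L[ℂ] K)} (hP : ∀ i a, Commute (π a) (P i)) (hP1 : ∀ i, ‖P i‖ < 1)
    (hsa : ∀ i, IsSelfAdjoint (P i)) : evalAt π x (fun i => U i * P i) = 0 := by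
  set c : ℂ → Fin n → (K →L[ℂ] K) := fun z i => U i * moebius (P i) z with hc
  have hd (z : ℂ) (hz : ‖z‖ ≤ 1) : DifferentiableAt ℂ c z :=
    differentiableAt_pi.2 fun i => (differentiableAt_moebius (hP1 i) hz).const_mul (U i)
  have hm (z : ℂ) (hz : ‖z‖ ≤ 1) : c z ∈ covariantContractions σ π :=
    mul_mem_covariantContractions hU (fun i a => commute_moebius (hP i a) z)
      fun i => norm_moebius_le (hP1 i) (hsa i) hz
  have hdc : DiffContOnCl ℂ (fun z => evalAt π x (c z)) (Metric.ball 0 1) := by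
    constructor
    · exact differentiableOn_evalAt_comp hx Metric.isOpen_ball
        (fun z hz => (hd z (mem_ball_zero_iff.1 hz).le).differentiableWithinAt)
        fun z hz => hm z (mem_ball_zero_iff.1 hz).le
    · rw [closure_ball _ one_ne_zero]
      exact continuousOn_evalAt_comp hx
        (fun z hz => (hd z (mem_closedBall_zero_iff.1 hz)).continuousAt.continuousWithinAt)
        fun z hz => hm z (mem_closedBall_zero_iff.1 hz)
  have h0 := Complex.eqOn_of_eqOn_frontier (g := fun _ => 0) Metric.isBounded_ball hdc
    diffContOnCl_const (fun z hz => by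
      rw [frontier_ball _ one_ne_zero, mem_sphere_zero_iff_norm] at hz
      exact hx0 _ (hm z hz.le) fun i => mul_mem (hU' i) (moebius_mem_unitary (hP1 i) (hsa i) hz))
    (Metric.mem_ball_self one_pos)
  simpa [hc] using h0

/-- Self-adjoint tuples are totally real, so the identity theorem removes self-adjointness. -/
theorem evalAt_mul_eq_zero_of_norm_le (hx : x ∈ Semicrossed σ)
    (hx0 : ∀ S ∈ covariantContractions σ π, (∀ i, S i ∈ unitary (K →L[ℂ] K)) → evalAt π x S = 0)
    (hU : U ∈ covariantContractions σ π) (hU' : ∀ i, U i ∈ unitary (K →L[ℂ] K))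
    {C : Fin n → (K →L[ℂ] K)} (hC : ∀ i a, Commute (π a) (C i)) (hC1 : ∀ i, ‖C i‖ ≤ 1 / 4) :
    evalAt π x (fun i => U i * C i) = 0 := by
  set R : Fin n → (K →L[ℂ] K) := fun i => realPart (C i)
  set J : Fin n → (K →L[ℂ] K) := fun i => imaginaryPart (C i)
  have hC' (i : Fin n) (a : A) : Commute (π a) (star (C i)) := by
    have := (hC i (star a)).star_star
    rwa [map_star, star_star] at this
  have hR (i : Fin n) (a : A) : Commute (π a) (R i) := by
    simp only [R, realPart_apply_coe]
    exact ((hC i a).add_right (hC' i a)).smul_right _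
  have hJ (i : Fin n) (a : A) : Commute (π a) (J i) := by
    simp only [J, imaginaryPart_apply_coe]
    exact (((hC i a).sub_right (hC' i a)).smul_right _).smul_right _
  have hR1 (i : Fin n) : ‖R i‖ ≤ 1 / 4 := (realPart.norm_le (C i)).trans (hC1 i)
  have hJ1 (i : Fin n) : ‖J i‖ ≤ 1 / 4 := (imaginaryPart.norm_le (C i)).trans (hC1 i)
  -- the disc of radius `2` contains `i`, and `1 / 4 + 2 * (1 / 4) < 1`
  have hn (z : ℂ) (hz : ‖z‖ < 2) (i : Fin n) : ‖R i + z • J i‖ < 1 := by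
    have h1 := norm_add_le (R i) (z • J i)
    rw [norm_smul] at h1
    nlinarith [hR1 i, hJ1 i, norm_nonneg z, norm_nonneg (J i)]
  have hcomm (z : ℂ) (i : Fin n) (a : A) : Commute (π a) (R i + z • J i) :=
    (hR i a).add_right ((hJ i a).smul_right z)
  have han : AnalyticOnNhd ℂ (fun z : ℂ => evalAt π x (fun i => U i * (R i + z • J i)))
      (Metric.ball 0 2) := by
    refine DifferentiableOn.analyticOnNhd (differentiableOn_evalAt_comp hx Metric.isOpen_ball
      (Differentiable.differentiableOn ?_) fun z hz =>
        mul_mem_covariantContractions hU (hcomm z) fun i => (hn z ?_ i).le) Metric.isOpen_ball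
    · fun_prop
    · simpa using hz
  have hfreq : ∃ᶠ z in 𝓝[≠] (0 : ℂ), evalAt π x (fun i => U i * (R i + z • J i)) = 0 := by
    have ht : Tendsto (fun t : ℝ => (t : ℂ)) (𝓝[≠] 0) (𝓝[≠] 0) := by
      refine tendsto_nhdsWithin_of_tendsto_nhds_of_eventually_within _ ?_ ?_
      · exact (Complex.continuous_ofReal.tendsto' 0 0 Complex.ofReal_zero).mono_left
          nhdsWithin_le_nhds
      · filter_upwards [self_mem_nhdsWithin] with t ht
        simpa using ht
    refine ht.frequently (Eventually.frequently ?_)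
    filter_upwards [mem_nhdsWithin_of_mem_nhds (Metric.ball_mem_nhds (0 : ℝ) two_pos)] with t ht
    refine evalAt_mul_selfAdjoint_eq_zero hx hx0 hU hU' (hcomm t) (hn t (by simpa using ht))
      fun i => (realPart (C i)).2.add ?_
    rw [IsSelfAdjoint, star_smul, (imaginaryPart (C i)).2.star_eq, Complex.star_def,
      Complex.conj_ofReal]
  have h := han.eqOn_zero_of_preconnected_of_frequently_eq_zero
    (convex_ball (0 : ℂ) 2).isPreconnected (Metric.mem_ball_self two_pos) hfreq
    (show Complex.I ∈ Metric.ball (0 : ℂ) 2 by simp)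
  simpa [R, J, realPart_add_I_smul_imaginaryPart] using h

/-- If an element of the semicrossed product vanishes on the unitary tuples covariant with `π`,
of which there is at least one, then it vanishes on all contractive tuples covariant with `π`. -/
theorem evalAt_eq_zero_of_unitary (hx : x ∈ Semicrossed σ)
    (hx0 : ∀ S ∈ covariantContractions σ π, (∀ i, S i ∈ unitary (K →L[ℂ] K)) → evalAt π x S = 0)
    (hU : U ∈ covariantContractions σ π) (hU' : ∀ i, U i ∈ unitary (K →L[ℂ] K))
    {S : Fin n → (K →L[ℂ] K)} (hS : S ∈ covariantContractions σ π) : evalAt π x S = 0 := by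
  have hcomm (z : ℂ) (i : Fin n) (a : A) : Commute (π a) (z • (star (U i) * S i)) :=
    (commute_star_mul hU hS i a).smul_right z
  have hn (z : ℂ) (i : Fin n) : ‖z • (star (U i) * S i)‖ ≤ ‖z‖ := by
    rw [norm_smul]
    refine mul_le_of_le_one_right (norm_nonneg z) ((norm_mul_le _ _).trans ?_)
    exact mul_le_one₀ ((norm_star (U i)).trans_le (hU.1 i)) (norm_nonneg _) (hS.1 i)
  have hm (z : ℂ) (hz : ‖z‖ ≤ 1) :
      (fun i => U i * (z • (star (U i) * S i))) ∈ covariantContractions σ π :=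
    mul_mem_covariantContractions hU (hcomm z) fun i => (hn z i).trans hz
  have han : AnalyticOnNhd ℂ (fun z : ℂ => evalAt π x (fun i => U i * (z • (star (U i) * S i))))
      (Metric.ball 0 1) := by
    refine DifferentiableOn.analyticOnNhd (differentiableOn_evalAt_comp hx Metric.isOpen_ball
      (Differentiable.differentiableOn ?_) fun z hz => hm z ?_) Metric.isOpen_ball
    · fun_prop
    · exact (mem_ball_zero_iff.1 hz).le
  have h0 := han.eqOn_zero_of_preconnected_of_eventuallyEq_zero
    (convex_ball (0 : ℂ) 1).isPreconnected (Metric.mem_ball_self one_pos) (by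
      filter_upwards [Metric.closedBall_mem_nhds (0 : ℂ) (by norm_num : (0 : ℝ) < 1 / 4)] with z hz
      exact evalAt_mul_eq_zero_of_norm_le hx hx0 hU hU' (hcomm z) fun i =>
        (hn z i).trans (mem_closedBall_zero_iff.1 hz))
  have hcont : ContinuousOn (fun z : ℂ => evalAt π x (fun i => U i * (z • (star (U i) * S i))))
      (Metric.closedBall 0 1) :=
    continuousOn_evalAt_comp hx (Continuous.continuousOn (by fun_prop))
      fun z hz => hm z (mem_closedBall_zero_iff.1 hz)
  have h1 := h0.of_subset_closure hcont continuousOn_const Metric.ball_subset_closedBall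
    (closure_ball (0 : ℂ) one_ne_zero).ge (show (1 : ℂ) ∈ Metric.closedBall 0 1 by simp)
  simpa [← mul_assoc, Unitary.mul_star_self_of_mem (hU' _)] using h1

end Uniqueness

/-! ### The regular amplification of a representation -/

section Amplification

variable {H : Type*} [NormedAddCommGroup H] [InnerProductSpace ℂ H] {G : Type*}

/-- The Hilbert space `ℓ²(G, H)`. -/
abbrev EllTwo (G H : Type*) [NormedAddCommGroup H] : Type _ := lp (fun _ : G => H) 2

/-- The diagonal operator on `ℓ²(G, H)` with the uniformly bounded entries `T g`. -/
def diagonalOp (T : G → (H →L[ℂ] H)) (C : ℝ) (hT : ∀ g, ‖T g‖ ≤ C) :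
    EllTwo G H →L[ℂ] EllTwo G H :=
  have hle (ξ : EllTwo G H) (g : G) : ‖T g (ξ g)‖ ≤ ‖((C : ℂ) • ξ) g‖ := by
    have hC : 0 ≤ C := (norm_nonneg _).trans (hT g)
    rw [lp.coeFn_smul, Pi.smul_apply, norm_smul, Complex.norm_real, Real.norm_of_nonneg hC]
    exact (T g).le_of_opNorm_le (hT g) _
  LinearMap.mkContinuous
    { toFun ξ := ⟨fun g => T g (ξ g), (lp.memℓp ((C : ℂ) • ξ)).mono' (hle ξ)⟩
      map_add' ξ η := lp.ext (funext fun g => map_add (T g) (ξ g) (η g))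
      map_smul' c ξ := lp.ext (funext fun g => map_smul (T g) c (ξ g)) } |C| fun ξ => by
    refine (lp.norm_mono two_ne_zero (hle ξ)).trans ?_
    rw [norm_smul, Complex.norm_real, Real.norm_eq_abs]

/-- The unitary operator on `ℓ²(G, H)` permuting the coordinates by `e`. -/
def permOp (e : G ≃ G) : EllTwo G H ≃ₗᵢ[ℂ] EllTwo G H where
  toFun ξ := ⟨fun g => ξ (e g), memℓp_gen ((e.summable_iff (f := fun g =>
    ‖ξ g‖ ^ (2 : ℝ≥0∞).toReal)).2 ((lp.memℓp ξ).summable (by simp)))⟩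
  invFun ξ := ⟨fun g => ξ (e.symm g), memℓp_gen ((e.symm.summable_iff (f := fun g =>
    ‖ξ g‖ ^ (2 : ℝ≥0∞).toReal)).2 ((lp.memℓp ξ).summable (by simp)))⟩
  map_add' _ _ := rfl
  map_smul' _ _ := rfl
  left_inv ξ := lp.ext (funext fun g => by simp)
  right_inv ξ := lp.ext (funext fun g => by simp)
  norm_map' ξ := by
    rw [lp.norm_eq_tsum_rpow (by simp), lp.norm_eq_tsum_rpow (by simp)]
    congr 1
    exact e.tsum_eq (fun g => ‖ξ g‖ ^ (2 : ℝ≥0∞).toReal)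

open Classical in
/-- The embedding of `H` into `ℓ²(G, H)` as the coordinate of `1`. -/
def embedOne [One G] : H →L[ℂ] EllTwo G H := lp.singleContinuousLinearMap ℂ (fun _ : G => H) 2 1

open Classical in
theorem embedOne_apply [One G] (ξ : H) (g : G) : embedOne ξ g = if g = 1 then ξ else 0 := by
  by_cases h : g = 1
  · subst h; simp [embedOne]
  · simp [embedOne, h]

theorem embedOne_injective [One G] : Function.Injective (embedOne : H →L[ℂ] EllTwo G H) :=
  fun ξ η h => by
    classical
    simpa [embedOne_apply] using congrArg (fun ζ : EllTwo G H => ζ 1) h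

theorem norm_embedOne_le [One G] : ‖(embedOne : H →L[ℂ] EllTwo G H)‖ ≤ 1 := by
  classical
  refine ContinuousLinearMap.opNorm_le_bound _ zero_le_one fun ξ => ?_
  rw [one_mul, embedOne, lp.singleContinuousLinearMap_apply, lp.norm_single (by simp)]

/-- The projection of `ℓ²(G, H)` onto the coordinate of `1`. -/
def evalOne [One G] : EllTwo G H →L[ℂ] H :=
  LinearMap.mkContinuous
    { toFun ξ := ξ 1
      map_add' _ _ := rfl
      map_smul' _ _ := rfl } 1 fun ξ => (lp.norm_apply_le_norm two_ne_zero ξ 1).trans (one_mul _).ge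

@[simp] theorem evalOne_apply [One G] (ξ : EllTwo G H) : evalOne ξ = ξ 1 := rfl

theorem norm_evalOne_le [One G] : ‖(evalOne : EllTwo G H →L[ℂ] H)‖ ≤ 1 :=
  LinearMap.mkContinuous_norm_le _ zero_le_one _

variable [CompleteSpace H]

/-- The regular amplification of a representation `π` of `A` to `ℓ²(Aut A, H)`: the coordinate of
an automorphism `g` carries the representation `π ∘ g`. -/
def amplify (π : A →⋆ₙₐ[ℂ] (H →L[ℂ] H)) :
    A →⋆ₙₐ[ℂ] (EllTwo (A ≃⋆ₐ[ℂ] A) H →L[ℂ] EllTwo (A ≃⋆ₐ[ℂ] A) H) where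
  toFun a := diagonalOp (fun g => π (g a)) ‖a‖ fun g =>
    (NonUnitalStarAlgHom.norm_apply_le (π.comp (g : A →⋆ₙₐ[ℂ] A)) a)
  map_smul' c a := by
    ext ξ : 1
    refine lp.ext (funext fun g => ?_)
    change π (g (c • a)) (ξ g) = c • π (g a) (ξ g)
    simp
  map_zero' := by
    ext ξ : 1
    refine lp.ext (funext fun g => ?_)
    change π (g 0) (ξ g) = 0
    simp
  map_add' a b := by
    ext ξ : 1
    refine lp.ext (funext fun g => ?_)
    change π (g (a + b)) (ξ g) = π (g a) (ξ g) + π (g b) (ξ g)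
    simp
  map_mul' a b := by
    ext ξ : 1
    refine lp.ext (funext fun g => ?_)
    change π (g (a * b)) (ξ g) = π (g a) (π (g b) (ξ g))
    simp
  map_star' a := by
    rw [ContinuousLinearMap.star_eq_adjoint, ContinuousLinearMap.eq_adjoint_iff]
    intro ξ η
    rw [lp.inner_eq_tsum, lp.inner_eq_tsum]
    refine tsum_congr fun g => ?_
    change inner ℂ (π (g (star a)) (ξ g)) (η g) = inner ℂ (ξ g) (π (g a) (η g))
    rw [map_star, map_star, ContinuousLinearMap.star_eq_adjoint,
      ContinuousLinearMap.adjoint_inner_left]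

@[simp] theorem amplify_apply (π : A →⋆ₙₐ[ℂ] (H →L[ℂ] H)) (a : A)
    (ξ : EllTwo (A ≃⋆ₐ[ℂ] A) H) (g : A ≃⋆ₐ[ℂ] A) : amplify π a ξ g = π (g a) (ξ g) := rfl

/-- The coordinate permutation of `ℓ²(Aut A, H)` that implements the automorphism `s` in the
amplified representations. -/
def regularUnitary (s : A ≃⋆ₐ[ℂ] A) :
    unitary (EllTwo (A ≃⋆ₐ[ℂ] A) H →L[ℂ] EllTwo (A ≃⋆ₐ[ℂ] A) H) :=
  Unitary.linearIsometryEquiv.symm (permOp (Equiv.mulRight s⁻¹))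

theorem regularUnitary_apply (s : A ≃⋆ₐ[ℂ] A) (ξ : EllTwo (A ≃⋆ₐ[ℂ] A) H) (g : A ≃⋆ₐ[ℂ] A) :
    (regularUnitary (H := H) s : EllTwo _ H →L[ℂ] EllTwo _ H) ξ g = ξ (g * s⁻¹) := by
  rw [regularUnitary, Unitary.coe_symm_linearIsometryEquiv_apply]
  rfl

theorem amplify_mul_regularUnitary (π : A →⋆ₙₐ[ℂ] (H →L[ℂ] H)) (s : A ≃⋆ₐ[ℂ] A) (a : A) :
    amplify π a * (regularUnitary (H := H) s : EllTwo _ H →L[ℂ] EllTwo _ H) =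
      (regularUnitary (H := H) s : EllTwo _ H →L[ℂ] EllTwo _ H) * amplify π (s a) := by
  ext ξ : 1
  refine lp.ext (funext fun g => ?_)
  have h : (g * s⁻¹) (s a) = g a := congrArg g (s.symm_apply_apply a)
  rw [mul_apply_eq_comp, mul_apply_eq_comp, amplify_apply, regularUnitary_apply,
    regularUnitary_apply, amplify_apply, h]

end Amplification

/-! ### Unitary covariant representations determine the semicrossed product -/

section Vanishing

variable {σ : Fin n → (A ≃⋆ₐ[ℂ] A)}

/-- An intertwiner of two covariant representations intertwines the images of the whole
semicrossed product. -/
theorem component_intertwine {r t : CovRep σ} (V : r.H →L[ℂ] t.H)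
    (hπ : ∀ a ξ, t.π a (V ξ) = V (r.π a ξ)) (hS : ∀ i ξ, t.S i (V ξ) = V (r.S i ξ))
    {x : BlockOps (fun r : CovRep σ => r)} (hx : x ∈ Semicrossed σ) (ξ : r.H) :
    component (fun r : CovRep σ => r) t x (V ξ) = V (component (fun r : CovRep σ => r) r x ξ) := by
  have hcont (q : CovRep σ) : Continuous (component (fun r : CovRep σ => r) q) :=
    AddMonoidHomClass.continuous_of_bound _ 1 fun y => by
      simpa using norm_component_le (fun r : CovRep σ => r) q y
  have hcl : IsClosed {y | ∀ ξ, component (fun r : CovRep σ => r) t y (V ξ) =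
      V (component (fun r : CovRep σ => r) r y ξ)} := by
    simp only [Set.ofPred_forall]
    refine isClosed_iInter fun ξ => isClosed_eq ?_ ?_
    · exact (hcont t).clm_apply continuous_const
    · exact V.continuous.comp ((hcont r).clm_apply continuous_const)
  refine closure_minimal (fun y hy => ?_) hcl hx ξ
  induction hy using NonUnitalAlgebra.adjoin_induction with
  | mem y hy =>
    rcases hy with ⟨a, rfl⟩ | hy
    · exact hπ a
    · obtain ⟨i, a, rfl⟩ := Set.mem_iUnion.1 hy
      exact fun ξ => (congrArg (t.S i) (hπ a ξ)).trans (hS i _)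
  | add y z _ _ hy hz => exact fun ξ => by simp [hy ξ, hz ξ]
  | zero => exact fun ξ => by simp
  | mul y z _ _ hy hz => exact fun ξ => by simp [hz ξ, hy (component (fun r : CovRep σ => r) r z ξ)]
  | smul c y _ hy => exact fun ξ => by simp [hy ξ]

/-- The semicrossed product embeds in the crossed product: an element that vanishes in all
unitary covariant representations is zero. -/
theorem eq_zero_of_component_unitary {x : BlockOps (fun r : CovRep σ => r)}
    (hx : x ∈ Semicrossed σ)
    (hx0 : ∀ r : UnitaryCovRep σ, component (fun r : CovRep σ => r) r.1 x = 0) : x = 0 := by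
  refine BlockOps.ext fun r => ?_
  rw [map_zero]
  set S : Fin n → (EllTwo (A ≃⋆ₐ[ℂ] A) r.H →L[ℂ] EllTwo (A ≃⋆ₐ[ℂ] A) r.H) :=
    fun i => embedOne ∘L r.S i ∘L evalOne with hSdef
  have hem (a : A) (ξ : r.H) : amplify r.π a (embedOne ξ) = embedOne (r.π a ξ) := by
    refine lp.ext (funext fun g => ?_)
    rw [amplify_apply, embedOne_apply, embedOne_apply]
    split_ifs with hg
    · rw [hg, StarAlgEquiv.one_apply]
    · rw [map_zero]
  have hev (ξ : r.H) : evalOne (embedOne ξ : EllTwo (A ≃⋆ₐ[ℂ] A) r.H) = ξ := by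
    rw [evalOne_apply, embedOne_apply, if_pos rfl]
  have hS : S ∈ covariantContractions σ (amplify r.π) := by
    refine ⟨fun i => ?_, fun i a => ?_⟩
    · refine (ContinuousLinearMap.opNorm_comp_le _ _).trans
        (mul_le_one₀ norm_embedOne_le (norm_nonneg _) ?_)
      exact (ContinuousLinearMap.opNorm_comp_le _ _).trans
        (mul_le_one₀ (r.norm_S_le i) (norm_nonneg _) norm_evalOne_le)
    · ext ξ : 1
      change amplify r.π a (embedOne (r.S i (ξ 1))) = embedOne (r.S i (r.π (σ i a) (ξ 1)))
      rw [hem]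
      exact congrArg embedOne (congrArg (fun X : r.H →L[ℂ] r.H => X (ξ 1)) (r.covariant i a))
  have hU : (fun i => (regularUnitary (H := r.H) (σ i) : EllTwo _ r.H →L[ℂ] EllTwo _ r.H)) ∈
      covariantContractions σ (amplify r.π) :=
    ⟨fun i => by
      have h := CStarRing.norm_coe_unitary_mul (regularUnitary (H := r.H) (σ i)) 1
      rw [mul_one] at h
      exact h.trans_le ContinuousLinearMap.norm_id_le,
      fun i a => amplify_mul_regularUnitary r.π (σ i) a⟩
  have h0 := evalAt_eq_zero_of_unitary hx
    (fun S hS hS' => (evalAt_of_mem x hS).trans (hx0 ⟨CovRep.ofMem hS, hS'⟩)) hU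
    (fun i => (regularUnitary (σ i)).2) hS
  rw [evalAt_of_mem x hS] at h0
  ext ξ : 1
  refine embedOne_injective (G := A ≃⋆ₐ[ℂ] A) ?_
  have h1 := component_intertwine (r := r) (t := CovRep.ofMem hS) embedOne hem
    (fun i ξ => congrArg (fun η => embedOne (r.S i η)) (hev ξ)) hx ξ
  refine h1.symm.trans ?_
  rw [zero_apply, map_zero]
  exact congrArg (fun X : EllTwo _ r.H →L[ℂ] EllTwo _ r.H => X (embedOne ξ)) h0

end Vanishing

/-! ### Normal operators in finite dimensions -/

section FiniteDimensional

variable {E : Type*} [NormedAddCommGroup E] [InnerProductSpace ℂ E] [FiniteDimensional ℂ E]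

/-- Normal operators on finite dimensional Hilbert spaces are diagonalizable. -/
theorem iSup_eigenspace_eq_top_of_isStarNormal [CompleteSpace E] {X : E →L[ℂ] E}
    (hX : IsStarNormal X) : ⨆ μ : ℂ, Module.End.eigenspace (X : E →ₗ[ℂ] E) μ = ⊤ := by
  rw [eq_top_iff, ← Module.End.iSup_maxGenEigenspace_eq_top (X : E →ₗ[ℂ] E)]
  refine iSup_mono fun μ ξ hξ => ?_
  obtain ⟨k, hk⟩ := Module.End.mem_maxGenEigenspace _ _ _ |>.1 hξ
  set N : E →L[ℂ] E := X - algebraMap ℂ _ μ with hN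
  have hNf (η : E) : ((X : E →ₗ[ℂ] E) - μ • 1) η = N η := by
    simp [hN, Algebra.algebraMap_eq_smul_one]
  have hNn : IsStarNormal N := by
    constructor
    rw [hN, star_sub, ← algebraMap_star_comm]
    exact (hX.star_comm_self.sub_left (Algebra.commute_algebraMap_left _ _)).sub_right
      (Algebra.commute_algebraMap_right _ _)
  have hN2 (η : E) (h : N (N η) = 0) : N η = 0 := by
    have h1 : N η ∈ (N.range)ᗮ := by
      rw [ContinuousLinearMap.IsStarNormal.orthogonal_range hNn]
      exact h
    exact inner_self_eq_zero.1 ((Submodule.mem_orthogonal _ _).1 h1 (N η) ⟨η, rfl⟩)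
  have hNk (k : ℕ) : ∀ η : E, (((X : E →ₗ[ℂ] E) - μ • 1) ^ k) η = 0 → N η = 0 := by
    induction k with
    | zero => intro η h; rw [show η = 0 from h, map_zero]
    | succ k ih =>
      intro η h
      rw [pow_succ, Module.End.mul_apply, hNf] at h
      exact hN2 η (ih _ h)
  rw [Module.End.mem_eigenspace_iff, ← sub_eq_zero]
  exact (hNf ξ).trans (hNk k ξ hk)

theorem mul_eq_one_comm_of_finiteDimensional {X Y : E →L[ℂ] E} (h : X * Y = 1) : Y * X = 1 := by
  have h1 : (X : E →ₗ[ℂ] E) * (Y : E →ₗ[ℂ] E) = 1 :=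
    congrArg (fun Z : E →L[ℂ] E => (Z : E →ₗ[ℂ] E)) h
  rw [mul_eq_one_comm] at h1
  exact ContinuousLinearMap.coe_injective h1

/-- In finite dimensions, a partial isometry `v` whose final space is contained in its initial
space is normal: `v + (1 - v*v)` is an isometry, hence a unitary. -/
theorem isStarNormal_of_partialIsometry [CompleteSpace E] {v p : E →L[ℂ] E} (h1 : star v * v = p)
    (h2 : v * p = v) (h3 : p * v = v) : IsStarNormal v := by
  have hps : star p = p := by rw [← h1, star_mul, star_star]
  have hpp : p * p = p := by
    nth_rw 1 [← h1]
    rw [mul_assoc, h2, h1]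
  have h4 : star v * p = star v := by
    rw [← hps, ← star_mul, h3]
  have h5 : p * star v = star v := by
    rw [← hps, ← star_mul, h2]
  have hw : (star v + (1 - p)) * (v + (1 - p)) = 1 := by
    simp only [add_mul, mul_add, sub_mul, mul_sub, one_mul, mul_one, h1, h3, h4, hpp]
    abel
  have hw' := mul_eq_one_comm_of_finiteDimensional hw
  simp only [add_mul, mul_add, sub_mul, mul_sub, one_mul, mul_one, h2, h5, hpp] at hw'
  rw [sub_self, add_zero, sub_self, add_zero, add_sub_cancel_left] at hw'
  have h6 : v * star v = p := by rw [eq_sub_of_add_eq hw', sub_sub_cancel]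
  exact ⟨by rw [Commute, SemiconjBy, h1, h6]⟩

/-- The image of a C*-algebra under a finite dimensional representation is unital: the
images of an approximate unit have a cluster point. -/
theorem exists_map_unit_of_finiteDimensional [CompleteSpace E] (f : A →⋆ₙₐ[ℂ] (E →L[ℂ] E)) :
    ∃ e : A, (∀ a, f e * f a = f a) ∧ star (f e) = f e := by
  let _ := CStarAlgebra.spectralOrder A
  have _ := CStarAlgebra.spectralOrderedRing A
  have hl := CStarAlgebra.increasingApproximateUnit A
  have hf : Continuous f := AddMonoidHomClass.continuous_of_bound f 1 fun y => by
    simpa using NonUnitalStarAlgHom.norm_apply_le f y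
  obtain ⟨p, -, hp⟩ := (isCompact_closedBall (0 : E →L[ℂ] E) 1).exists_mapClusterPt
    (f := CStarAlgebra.approximateUnit A) (u := f) (by
      rw [le_principal_iff, mem_map]
      filter_upwards [hl.eventually_norm] with a ha
      exact mem_closedBall_zero_iff.2 ((NonUnitalStarAlgHom.norm_apply_le f a).trans ha))
  obtain ⟨l, hlA, hlp⟩ := mapClusterPt_iff_ultrafilter.1 hp
  have hpmem : p ∈ LinearMap.range (f : A →ₗ[ℂ] (E →L[ℂ] E)) :=
    (Submodule.closed_of_finiteDimensional _).mem_of_tendsto hlp (.of_forall fun a => ⟨a, rfl⟩)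
  obtain ⟨e, rfl⟩ := hpmem
  have h1 (a : A) : f e * f a = f a := by
    refine tendsto_nhds_unique (hlp.mul_const (f a)) ?_
    simp only [← map_mul]
    exact (hf.tendsto a).comp ((hl.tendsto_mul_right a).mono_left hlA)
  have h2 : star (f e) = f e := by
    have h3 := h1 (star e)
    have h4 := congrArg star h3
    rw [map_star] at h3 h4
    rw [star_mul, star_star] at h4
    rw [← h3, h4]
  exact ⟨e, h1, h2⟩

end FiniteDimensional

/-! ### Local multipliers and diagonalizable operators -/

section LocalMultipliers

variable {B : Type*} [NonUnitalRing B] [TopologicalSpace B] [Module ℂ B]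
  {E : Type*} [NormedAddCommGroup E] [NormedSpace ℂ E]

/-- An approximately local left multiplier does not enlarge the kernel of an element. -/
theorem IsApproxLocalLeftMultiplier.map_apply_eq_zero {T : B →L[ℂ] B}
    (hT : IsApproxLocalLeftMultiplier T) (ψ : B →ₙₐ[ℂ] (E →L[ℂ] E)) (hψ : Continuous ψ)
    {b : B} {ξ : E} (h : ψ b ξ = 0) : ψ (T b) ξ = 0 := by
  obtain ⟨x, hx⟩ := hT b
  have h1 : Tendsto (fun k => ψ (x k * b) ξ) atTop (𝓝 (ψ (T b) ξ)) :=
    ((hψ.clm_apply continuous_const).tendsto (T b)).comp hx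
  refine tendsto_nhds_unique h1 ?_
  simp [h]

/-- An approximately local left multiplier respects right multiplication by elements that are
represented by diagonalizable operators: if `ψ(h)ξ = μξ`, then `ψ(bh - μb)ξ = 0`, and hence
`ψ(T(bh) - μT(b))ξ = 0`. -/
theorem IsApproxLocalLeftMultiplier.map_mul_of_diagonalizable {T : B →L[ℂ] B}
    (hT : IsApproxLocalLeftMultiplier T) (ψ : B →ₙₐ[ℂ] (E →L[ℂ] E)) (hψ : Continuous ψ) {h : B}
    (hh : ⨆ μ : ℂ, Module.End.eigenspace (ψ h : E →ₗ[ℂ] E) μ = ⊤) (b : B) :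
    ψ (T (b * h)) = ψ (T b) * ψ h := by
  have key : ⨆ μ : ℂ, Module.End.eigenspace (ψ h : E →ₗ[ℂ] E) μ ≤
      LinearMap.ker ((ψ (T (b * h)) - ψ (T b) * ψ h : E →L[ℂ] E) : E →ₗ[ℂ] E) := by
    refine iSup_le fun μ ξ hξ => ?_
    have hξ' : ψ h ξ = μ • ξ := Module.End.mem_eigenspace_iff.1 hξ
    have h1 := hT.map_apply_eq_zero ψ hψ (b := b * h - μ • b) (ξ := ξ) (by simp [hξ'])
    simpa [hξ'] using h1
  ext ξ
  have h1 : (ψ (T (b * h)) - ψ (T b) * ψ h) ξ = 0 := key (hh ▸ Submodule.mem_top)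
  exact sub_eq_zero.1 h1

/-- The elements `h` for which `T` commutes with right multiplication by `h` in the
representation `ψ`. -/
def rightMultiplicative (T : B →L[ℂ] B) (ψ : B →ₙₐ[ℂ] (E →L[ℂ] E)) [IsScalarTower ℂ B B]
    [SMulCommClass ℂ B B] : NonUnitalSubalgebra ℂ B where
  carrier := {h | ∀ b, ψ (T (b * h)) = ψ (T b) * ψ h}
  add_mem' {h k} hh hk b := by rw [mul_add, map_add, map_add, hh b, hk b, map_add, mul_add]
  zero_mem' b := by simp
  mul_mem' {h k} hh hk b := by rw [← mul_assoc, hk, hh, map_mul, mul_assoc]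
  smul_mem' c h hh b := by rw [mul_smul_comm, map_smul, map_smul, hh b, map_smul, mul_smul_comm]

theorem isClosed_rightMultiplicative [IsTopologicalSemiring B] [IsScalarTower ℂ B B]
    [SMulCommClass ℂ B B] (T : B →L[ℂ] B) (ψ : B →ₙₐ[ℂ] (E →L[ℂ] E)) (hψ : Continuous ψ) :
    IsClosed (rightMultiplicative T ψ : Set B) := by
  change IsClosed {h | ∀ b, ψ (T (b * h)) = ψ (T b) * ψ h}
  simp only [Set.ofPred_forall]
  refine isClosed_iInter fun b => isClosed_eq ?_ ?_
  · exact hψ.comp (T.continuous.comp (continuous_const.mul continuous_id))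
  · exact continuous_const.mul hψ

end LocalMultipliers

/-! ### Covariant partial isometries in finite dimensions -/

section PartialIsometries

variable {E : Type*} [NormedAddCommGroup E] [InnerProductSpace ℂ E] [CompleteSpace E]
  [FiniteDimensional ℂ E]

/-- Let `f` be a finite dimensional representation of `A`, with unit `f(e)`, and let `w(a)` multiply
like the elements `U a` for a unitary `U` with `U f(c) U* = f(s(c))`. Then `w(e)` is a unitary of the
support of `f`, extended by zero, and `w(a) = w(e) f(a)`. -/
theorem isStarNormal_and_map_mul_of_covariant (f : A →⋆ₙₐ[ℂ] (E →L[ℂ] E)) (w : A → (E →L[ℂ] E))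
    (s : A → A) (h1 : ∀ a b, star (w a) * w b = f (star a * b))
    (h2 : ∀ a b, w a * star (w b) = f (s (a * star b))) (h3 : ∀ a b, w a * f b = w (a * b))
    {e : A} (he : ∀ a, f e * f a = f a) (hes : star (f e) = f e) :
    IsStarNormal (w e) ∧ ∀ a, w (e * a) = w a := by
  have h4 {a b : A} (h : f a = f b) : w a = w b := by
    rw [← sub_eq_zero, ← CStarRing.star_mul_self_eq_zero_iff, star_sub, mul_sub, sub_mul, sub_mul,
      h1, h1, h1, h1]
    simp only [map_mul, h, sub_self]
  have h5 : star (w e) * w e = f e := by rw [h1, map_mul, map_star, hes, he]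
  have h6 : w e * f e = w e := by
    rw [h3]
    exact h4 (by rw [map_mul, he])
  refine ⟨isStarNormal_of_partialIsometry h5 h6 ?_, fun a => h4 (by rw [map_mul, he])⟩
  -- `w(e) = w(e) w(e)* w(e)`, and `w(e) w(e)*` belongs to the image of `A`
  have h7 : w e * star (w e) * w e = w e := by rw [mul_assoc, h5, h6]
  rw [← h7, h2, ← mul_assoc, he]

end PartialIsometries

/-! ### From the semicrossed product to the crossed product -/

section CrossedProduct

variable (σ : Fin n → (A ≃⋆ₐ[ℂ] A))

instance : IsClosed (Crossed σ : Set (BlockOps (fun r : UnitaryCovRep σ => r.1))) :=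
  NonUnitalStarSubalgebra.isClosed_topologicalClosure _

theorem generators_subset_crossed :
    generators (fun r : UnitaryCovRep σ => r.1) ⊆ Crossed σ :=
  (NonUnitalStarAlgebra.subset_adjoin ℂ _).trans subset_closure

theorem coeff_mem_crossed (a : A) : coeff (fun r : UnitaryCovRep σ => r.1) a ∈ Crossed σ :=
  generators_subset_crossed σ (.inl ⟨a, rfl⟩)

theorem shiftCoeff_mem_crossed (i : Fin n) (a : A) :
    shiftCoeff (fun r : UnitaryCovRep σ => r.1) i a ∈ Crossed σ :=
  generators_subset_crossed σ (.inr (Set.mem_iUnion.2 ⟨i, a, rfl⟩))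

/-- The canonical homomorphism of the coefficient algebra into the crossed product. -/
def coeffCrossed : A →⋆ₙₐ[ℂ] Crossed σ :=
  NonUnitalStarAlgHom.codRestrict (coeffHom (fun r : UnitaryCovRep σ => r.1)) (Crossed σ)
    (coeff_mem_crossed σ)

/-- The elements `Uᵢ a` of the crossed product. -/
def shiftCrossed (i : Fin n) (a : A) : Crossed σ := ⟨_, shiftCoeff_mem_crossed σ i a⟩

theorem star_shiftCrossed_mul_shiftCrossed (i : Fin n) (a b : A) :
    star (shiftCrossed σ i a) * shiftCrossed σ i b = coeffCrossed σ (star a * b) :=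
  Subtype.ext (star_shiftCoeff_mul_shiftCoeff _ i (fun r => r.2 i) a b)

theorem shiftCrossed_mul_star_shiftCrossed (i : Fin n) (a b : A) :
    shiftCrossed σ i a * star (shiftCrossed σ i b) = coeffCrossed σ ((σ i).symm (a * star b)) :=
  Subtype.ext (shiftCoeff_mul_star_shiftCoeff _ i (fun r => r.2 i) a b)

theorem shiftCrossed_mul_coeffCrossed (i : Fin n) (a b : A) :
    shiftCrossed σ i a * coeffCrossed σ b = shiftCrossed σ i (a * b) :=
  Subtype.ext (shiftCoeff_mul_coeff _ i a b)

/-- In a finite dimensional representation of the crossed product some `e ∈ A` acts as the unit of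
the image of `A`, and then `Uᵢ e` acts as a normal operator, by which `Uᵢ a` factors. -/
theorem exists_unit_isStarNormal {E : Type*} [NormedAddCommGroup E] [InnerProductSpace ℂ E]
    [CompleteSpace E] [FiniteDimensional ℂ E] (φ : Crossed σ →⋆ₙₐ[ℂ] (E →L[ℂ] E)) :
    ∃ e : A, ∀ i, IsStarNormal (φ (shiftCrossed σ i e)) ∧
      ∀ a, φ (shiftCrossed σ i (e * a)) = φ (shiftCrossed σ i a) := by
  obtain ⟨e, he1, he3⟩ := exists_map_unit_of_finiteDimensional (φ.comp (coeffCrossed σ))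
  refine ⟨e, fun i => isStarNormal_and_map_mul_of_covariant (φ.comp (coeffCrossed σ))
    (fun a => φ (shiftCrossed σ i a)) (σ i).symm (fun a b => ?_) (fun a b => ?_) (fun a b => ?_)
    he1 he3⟩
  · exact ((map_mul φ _ _).trans (congrArg (· * _) (map_star φ _))).symm.trans
      (congrArg φ (star_shiftCrossed_mul_shiftCrossed σ i a b))
  · exact ((map_mul φ _ _).trans (congrArg (_ * ·) (map_star φ _))).symm.trans
      (congrArg φ (shiftCrossed_mul_star_shiftCrossed σ i a b))
  · exact (map_mul φ _ _).symm.trans (congrArg φ (shiftCrossed_mul_coeffCrossed σ i a b))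

theorem continuous_reindex {ι κ : Type*} {σ : Fin n → (A ≃⋆ₐ[ℂ] A)} (ρ : ι → CovRep σ) (f : κ → ι) :
    Continuous (reindex ρ f) :=
  AddMonoidHomClass.continuous_of_bound _ 1 fun y => by
    simpa using NonUnitalStarAlgHom.norm_apply_le (reindex ρ f) y

theorem reindex_mem_crossed {x : BlockOps (fun r : CovRep σ => r)} (hx : x ∈ Semicrossed σ) :
    reindex (fun r : CovRep σ => r) (fun r : UnitaryCovRep σ => r.1) x ∈ Crossed σ := by
  have hcl : IsClosed {y | reindex (fun r : CovRep σ => r) (fun r : UnitaryCovRep σ => r.1) y ∈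
      Crossed σ} :=
    (NonUnitalStarSubalgebra.isClosed_topologicalClosure _).preimage (continuous_reindex _ _)
  refine closure_minimal (fun y hy => ?_) hcl hx
  induction hy using NonUnitalAlgebra.adjoin_induction with
  | mem y hy =>
    rcases hy with ⟨a, rfl⟩ | hy
    · exact coeff_mem_crossed σ a
    · obtain ⟨i, a, rfl⟩ := Set.mem_iUnion.1 hy
      exact shiftCoeff_mem_crossed σ i a
  | add y z _ _ hy hz => simpa using add_mem hy hz
  | zero => simp
  | mul y z _ _ hy hz => simpa using mul_mem hy hz
  | smul c y _ hy => simpa using SMulMemClass.smul_mem c hy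

/-- The canonical homomorphism from the semicrossed product to the crossed product. -/
def toCrossed : Semicrossed σ →ₙₐ[ℂ] Crossed σ where
  toFun x := ⟨_, reindex_mem_crossed σ x.2⟩
  map_smul' _ _ := rfl
  map_zero' := rfl
  map_add' _ _ := rfl
  map_mul' _ _ := rfl

theorem continuous_toCrossed : Continuous (toCrossed σ) :=
  ((continuous_reindex _ _).comp continuous_subtype_val).subtype_mk _

theorem toCrossed_injective : Function.Injective (toCrossed σ) := by
  refine (injective_iff_map_eq_zero _).2 fun x hx => Subtype.ext ?_
  refine eq_zero_of_component_unitary x.2 fun r => ?_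
  exact congrArg (fun y : Crossed σ => component (fun r : UnitaryCovRep σ => r.1) r y.1) hx

theorem adjoin_le_semicrossed :
    NonUnitalAlgebra.adjoin ℂ (generators (fun r : CovRep σ => r)) ≤ Semicrossed σ :=
  NonUnitalSubalgebra.le_topologicalClosure _

/-- The canonical homomorphism of the coefficient algebra into the semicrossed product. -/
def coeffSemicrossed : A →ₙₐ[ℂ] Semicrossed σ :=
  NonUnitalAlgHom.codRestrict (coeffHom (fun r : CovRep σ => r)) (Semicrossed σ) fun a =>
    adjoin_le_semicrossed σ (NonUnitalAlgebra.subset_adjoin ℂ (.inl ⟨a, rfl⟩))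

/-- The elements `Sᵢ a` of the semicrossed product. -/
def shiftSemicrossed (i : Fin n) (a : A) : Semicrossed σ :=
  ⟨shiftCoeff (fun r : CovRep σ => r) i a, adjoin_le_semicrossed σ
    (NonUnitalAlgebra.subset_adjoin ℂ (.inr (Set.mem_iUnion.2 ⟨i, a, rfl⟩)))⟩

theorem shiftSemicrossed_mul_coeffSemicrossed (i : Fin n) (a b : A) :
    shiftSemicrossed σ i a * coeffSemicrossed σ b = shiftSemicrossed σ i (a * b) :=
  Subtype.ext (shiftCoeff_mul_coeff _ i a b)

variable {σ} in
/-- A closed subalgebra of the semicrossed product that contains the generators is everything. -/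
theorem semicrossed_induction {N : NonUnitalSubalgebra ℂ (Semicrossed σ)}
    (hN : IsClosed (N : Set (Semicrossed σ)))
    (hcoeff : ∀ a, coeffSemicrossed σ a ∈ N) (hshift : ∀ i a, shiftSemicrossed σ i a ∈ N)
    (x : Semicrossed σ) : x ∈ N := by
  obtain ⟨y, hy, hyx⟩ := mem_closure_iff_seq_limit.1 x.2
  have hadj : ∀ y ∈ NonUnitalAlgebra.adjoin ℂ (generators (fun r : CovRep σ => r)),
      ∀ h : y ∈ Semicrossed σ, (⟨y, h⟩ : Semicrossed σ) ∈ N := by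
    intro y hy
    induction hy using NonUnitalAlgebra.adjoin_induction with
    | mem y hy =>
      rcases hy with ⟨a, rfl⟩ | hy
      · exact fun _ => hcoeff a
      · obtain ⟨i, a, rfl⟩ := Set.mem_iUnion.1 hy
        exact fun _ => hshift i a
    | add y z hy' hz' hy hz =>
      exact fun _ => add_mem (hy (adjoin_le_semicrossed σ hy')) (hz (adjoin_le_semicrossed σ hz'))
    | zero => exact fun _ => zero_mem N
    | mul y z hy' hz' hy hz =>
      exact fun _ => mul_mem (hy (adjoin_le_semicrossed σ hy')) (hz (adjoin_le_semicrossed σ hz'))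
    | smul c y hy' hy => exact fun _ => SMulMemClass.smul_mem c (hy (adjoin_le_semicrossed σ hy'))
  exact hN.mem_of_tendsto (tendsto_subtype_rng.2 hyx : Tendsto
    (fun k => (⟨y k, adjoin_le_semicrossed σ (hy k)⟩ : Semicrossed σ)) atTop (𝓝 x))
    (.of_forall fun k => hadj _ (hy k) _)

end CrossedProduct

/-! ### Approximately local left multipliers on the semicrossed product -/

variable {σ : Fin n → (A ≃⋆ₐ[ℂ] A)}

theorem continuous_of_crossed {E : Type*} [NormedAddCommGroup E] [InnerProductSpace ℂ E]
    [CompleteSpace E] (φ : Crossed σ →⋆ₙₐ[ℂ] (E →L[ℂ] E)) : Continuous φ :=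
  AddMonoidHomClass.continuous_of_bound φ 1 fun y => by
    simpa using NonUnitalStarAlgHom.norm_apply_le φ y

/-- An approximately local left multiplier on the semicrossed product becomes a left multiplier in
a finite dimensional representation in which the self-adjoint elements of `A` are normal, and so are
the `Sᵢ e` for some `e ∈ A` that acts as a unit between the `Sᵢ` and `A`. -/
theorem IsApproxLocalLeftMultiplier.map_mul_of_isStarNormal {E : Type*} [NormedAddCommGroup E]
    [InnerProductSpace ℂ E] [CompleteSpace E] [FiniteDimensional ℂ E]
    {T : Semicrossed σ →L[ℂ] Semicrossed σ} (hT : IsApproxLocalLeftMultiplier T)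
    (ψ : Semicrossed σ →ₙₐ[ℂ] (E →L[ℂ] E)) (hψ : Continuous ψ)
    (hsa : ∀ d : selfAdjoint A, IsStarNormal (ψ (coeffSemicrossed σ d))) {e : A}
    (he : ∀ i, IsStarNormal (ψ (shiftSemicrossed σ i e)))
    (he' : ∀ i d, ψ (shiftSemicrossed σ i (e * d)) = ψ (shiftSemicrossed σ i d))
    (a b : Semicrossed σ) : ψ (T (a * b)) = ψ (T a) * ψ b := by
  have hnormal {h : Semicrossed σ} (hh : IsStarNormal (ψ h)) : h ∈ rightMultiplicative T ψ :=
    hT.map_mul_of_diagonalizable ψ hψ (iSup_eigenspace_eq_top_of_isStarNormal hh)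
  have hcoeff (a : A) : coeffSemicrossed σ a ∈ rightMultiplicative T ψ := by
    rw [← realPart_add_I_smul_imaginaryPart a, map_add, map_smul]
    exact add_mem (hnormal (hsa _)) (SMulMemClass.smul_mem _ (hnormal (hsa _)))
  refine semicrossed_induction (isClosed_rightMultiplicative T ψ hψ) hcoeff (fun i d => ?_) b a
  have hker : shiftSemicrossed σ i d - shiftSemicrossed σ i (e * d) ∈ rightMultiplicative T ψ := by
    have h0 : ψ (shiftSemicrossed σ i d - shiftSemicrossed σ i (e * d)) = 0 := by
      rw [map_sub, he', sub_self]
    exact hnormal (h0 ▸ IsStarNormal.zero)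
  have hmul : shiftSemicrossed σ i (e * d) ∈ rightMultiplicative T ψ := by
    rw [← shiftSemicrossed_mul_coeffSemicrossed]
    exact mul_mem (hnormal (he i)) (hcoeff d)
  simpa using add_mem hker hmul

/-- The restriction of a representation of the crossed product to the semicrossed product. -/
def semicrossedRep {E : Type*} [NormedAddCommGroup E] [InnerProductSpace ℂ E] [CompleteSpace E]
    (φ : Crossed σ →⋆ₙₐ[ℂ] (E →L[ℂ] E)) : Semicrossed σ →ₙₐ[ℂ] (E →L[ℂ] E) :=
  (φ : Crossed σ →ₙₐ[ℂ] (E →L[ℂ] E)).comp (toCrossed σ)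

theorem semicrossedRep_apply {E : Type*} [NormedAddCommGroup E] [InnerProductSpace ℂ E]
    [CompleteSpace E] (φ : Crossed σ →⋆ₙₐ[ℂ] (E →L[ℂ] E)) (x : Semicrossed σ) :
    semicrossedRep φ x = φ (toCrossed σ x) := rfl

theorem IsApproxLocalLeftMultiplier.semicrossedRep_map_mul {E : Type*} [NormedAddCommGroup E]
    [InnerProductSpace ℂ E] [CompleteSpace E] [FiniteDimensional ℂ E]
    {T : Semicrossed σ →L[ℂ] Semicrossed σ} (hT : IsApproxLocalLeftMultiplier T)
    (φ : Crossed σ →⋆ₙₐ[ℂ] (E →L[ℂ] E)) (a b : Semicrossed σ) :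
    semicrossedRep φ (T (a * b)) = semicrossedRep φ (T a) * semicrossedRep φ b := by
  obtain ⟨e, he⟩ := exists_unit_isStarNormal σ φ
  refine hT.map_mul_of_isStarNormal (semicrossedRep φ)
    ((continuous_of_crossed φ).comp (continuous_toCrossed σ)) (fun d => ?_)
    (fun i => (he i).1) (fun i => (he i).2) a b
  have h : IsSelfAdjoint (φ.comp (coeffCrossed σ) d) := d.2.map _
  exact h.isStarNormal

end MultivarDyn

end

theorem proposition3p5 {A : Type*} [NonUnitalCStarAlgebra A] {n : ℕ}
    (σ : Fin n → (A ≃⋆ₐ[ℂ] A))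
    (hRFD : MultivarDyn.IsRFD (MultivarDyn.Crossed σ))
    (T : MultivarDyn.Semicrossed σ →L[ℂ] MultivarDyn.Semicrossed σ)
    (hT : MultivarDyn.IsApproxLocalLeftMultiplier T) :
    MultivarDyn.IsLeftMultiplier T := by
  intro a b
  by_contra hne
  obtain ⟨k, φ, hφ⟩ := hRFD (MultivarDyn.toCrossed σ (T (a * b) - T a * b)) fun h =>
    hne (sub_eq_zero.1 ((injective_iff_map_eq_zero _).1 (MultivarDyn.toCrossed_injective σ) _ h))
  refine hφ ?_
  rw [← MultivarDyn.semicrossedRep_apply, map_sub (MultivarDyn.semicrossedRep φ),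
    map_mul (MultivarDyn.semicrossedRep φ), hT.semicrossedRep_map_mul φ, sub_self]
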